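/- Let $k,d,n\ge 1$, let $\theta:[k]\to(0,\infty)$, $\theta_{\max}=\max_y\theta_y$, let $\Lambda_1,\dots,\Lambda_k\ge 0$, and write $\|W\|:=\big(\sum_{j=1}^k\Lambda_j^2\big)^{1/2}$, the Frobenius norm of a $k\times d$ matrix whose rows have Euclidean norms $\Lambda_1,\dots,\Lambda_k$ (the largest Frobenius norm in the class of weight matrices below). Let $P$ be a probability distribution on $\mathbb{R}^d\times[k]$ with $\|x\|\le R$ for $P$-almost every $(x,y)$, and let $S=((X_1,Y_1),\dots,(X_n,Y_n))$ be an i.i.d. sample from $P$. For a class $G$ of real functions on $\mathbb{R}^d\times[k]$ put $$\hat R_S(G)=\mathbb{E}_\sigma\sup_{g\in G}\frac1n\sum_{i=1}^n\sigma_i\,g(X_i,Y_i),\qquad R_n(G)=\mathbb{E}_S\,\hat R_S(G),$$ with $\sigma$ uniform on $\{-1,1\}^n$. For signs $s_j(y)\in\{-1,1\}$ $(j,y\in[k])$ let $F_j$ be the class of all functions $(x,y)\mapsto[\theta_y+s_j(y)\,w_j\cdot x]_+$ with $w_j\in\mathbb{R}^d$, $\|w_j\|\le\Lambda_j$, and let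 $F=\{\sum_{j=1}^k f_j: f_j\in F_j\}$ be their Minkowski sum. Then: 1. For every $j$ and every choice of the signs, $\hat R_S(F_j)\le R\Lambda_j/\sqrt n$ for every sample $S$ whose points satisfy $\|x_i\|\le R$; moreover $\hat R_S(F_j)$ is integrable in $S$ and $R_n(F_j)\le R\Lambda_j/\sqrt n$. 2. For every choice of the signs, $\hat R_S(F)\le \frac{R\sum_j\Lambda_j}{\sqrt n}$ for every such sample $S$; moreover $\hat R_S(F)$ is integrable in $S$ and $$R_n(F)\le\frac{R\sum_{j=1}^k\Lambda_j}{\sqrt n}\le R\,\|W\|\sqrt{\frac kn}.$$ 3. For a $k\times d$ matrix $V$ with rows $v_1,\dots,v_k$ let $\tilde L_V(x,y)=\sum_{j=1}^k[\theta_y-\bar\delta_{y,j}\,v_j\cdot x]_+$ be the surrogate loss, where $\bar\delta_{y,j}=1$ if $y=j$ and $-1$ otherwise, and let $\tilde L'_V=\min\{\tilde L_V,\theta_{\max}\}/\theta_{\max}$ be the clipped and normalised loss. Then for every $\delta\in(0,1)$, with probability at least $1-\delta$ over $S$, simultaneously for all $V$ with $\|v_j\|\le\Lambda_j$ for every $j$,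 $$\mathbb{E}_{(X,Y)\sim P}\big[\tilde L'_V(X,Y)\big]\le\frac1n\sum_{i=1}^n\tilde L'_V(X_i,Y_i)+2R\,\frac{\|W\|}{\theta_{\max}}\sqrt{\frac kn}+\sqrt{\frac{\log(1/\delta)}{2n}}.$$ -/

import Mathlib

open MeasureTheory

noncomputable section

/-- The empirical Rademacher complexity of a class `F` of real functions on the sample
`S = (z₁, …, zₙ)`: the average over all `2 ^ n` sign vectors `σ ∈ {-1, 1}ⁿ` of
`sup_{f ∈ F} (1/n) ∑ᵢ σᵢ f (zᵢ)`. -/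
def empRademacher {Z : Type*} {n : ℕ} (F : Set (Z → ℝ)) (S : Fin n → Z) : ℝ :=
  (1 / 2 ^ n : ℝ) * ∑ σ : Fin n → ℤˣ,
    ⨆ f : F, (1 / n : ℝ) * ∑ i, ((σ i : ℤ) : ℝ) * (f : Z → ℝ) (S i)

/-- The Rademacher complexity `R_n(F)`: the expectation of the empirical Rademacher complexity
over a sample of `n` independent points of law `P`. -/
def rademacher {Z : Type*} [MeasurableSpace Z] (P : Measure Z) (n : ℕ) (F : Set (Z → ℝ)) : ℝ :=
  ∫ S : Fin n → Z, empRademacher F S ∂(Measure.pi fun _ => P)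

/-- A labelled example `(x, y)` with `x ∈ ℝᵈ` and `y` one of `k` labels. -/
abbrev Example (d k : ℕ) : Type := EuclideanSpace ℝ (Fin d) × Fin k

/-- The class of all functions `(x, y) ↦ [θ_y ± w · x]₊` with `‖w‖ ≤ Λ`; the sign in front of
`w · x` is `s y`, so that it may depend on the label. -/
def hingeClass {d k : ℕ} (θ : Fin k → ℝ) (s : Fin k → ℤˣ) (Λ : ℝ) : Set (Example d k → ℝ) :=
  {f | ∃ w : EuclideanSpace ℝ (Fin d), ‖w‖ ≤ Λ ∧
    f = fun z => max (θ z.2 + ((s z.2 : ℤ) : ℝ) * inner ℝ w z.1) 0}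

/-- The Minkowski sum of a finite family of function classes. -/
def minkowskiSum {Z : Type*} {k : ℕ} (F : Fin k → Set (Z → ℝ)) : Set (Z → ℝ) :=
  {g | ∃ f : Fin k → Z → ℝ, (∀ j, f j ∈ F j) ∧ g = fun z => ∑ j, f j z}

/-- The Frobenius norm of a `k × d` matrix whose `j`-th row has Euclidean norm `Λ j`. -/
def frobeniusOfRows {k : ℕ} (Λ : Fin k → ℝ) : ℝ := √(∑ j, Λ j ^ 2)

/-- The signed Kronecker delta. -/
def signedDelta {k : ℕ} (y j : Fin k) : ℝ := if y = j then 1 else -1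

/-- The surrogate loss of the weight matrix `W` (given by its rows `w_j`) on the example `z`. -/
def surrogateLoss {d k : ℕ} (θ : Fin k → ℝ) (W : Fin k → EuclideanSpace ℝ (Fin d))
    (z : Example d k) : ℝ :=
  ∑ j, if signedDelta z.2 j * inner ℝ (W j) z.1 ≤ θ z.2
    then θ z.2 - signedDelta z.2 j * inner ℝ (W j) z.1 else 0

/-- `θ_max`, the largest of the finitely many priorities. -/
def thetaMax {k : ℕ} (θ : Fin k → ℝ) : ℝ := ⨆ y, θ y

/-- The surrogate loss clipped at `θ_max` and divided by `θ_max`. -/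
def clippedLoss {d k : ℕ} (θ : Fin k → ℝ) (W : Fin k → EuclideanSpace ℝ (Fin d))
    (z : Example d k) : ℝ :=
  min (surrogateLoss θ W z) (thetaMax θ) / thetaMax θ

end

/-! Two properties of averages over signs carry the proof. They are contractive: functions that vary
less at each sample point have a smaller mean supremum (`sum_iSup_signed_le_of_contraction`). And
independent signs are orthogonal, so a signed sum of n vectors of norm at most R has mean norm at
most R√n.

For fixed y the map t ↦ [θ_y ± t]₊ is 1-Lipschitz, so F_j is dominated by the linear functions w·x,
whose supremum over the ball is at most Λ_j times the norm of a signed sum. Subadditivity of suprema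
gives the Minkowski sum, and Cauchy–Schwarz turns ∑ Λ_j into √k ‖W‖.

The surrogate loss lies in the sum with signs −δ̄, and clipping and normalising is
(1/θ_max)-Lipschitz, so a second contraction bounds the complexity of the clipped losses. A general
bound for [0,1]-valued classes finishes: symmetrization with a ghost sample bounds the mean uniform
deviation by twice the Rademacher complexity, and McDiarmid's inequality controls the fluctuation
about that mean. -/

theorem empRademacher_range {Z ι : Type*} {n : ℕ} (g : ι → Z → ℝ) (S : Fin n → Z) :
    empRademacher (Set.range g) S
      = (1 / 2 ^ n : ℝ) * ∑ σ : Fin n → ℤˣ, ⨆ t, (1 / n : ℝ) * ∑ i, ((σ i : ℤ) : ℝ) * g t (S i) := by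
  unfold empRademacher
  congr 1
  refine Finset.sum_congr rfl fun σ _ => ?_
  exact iSup_range' (fun f : Z → ℝ => (1 / n : ℝ) * ∑ i, ((σ i : ℤ) : ℝ) * f (S i)) g

theorem abs_intUnit_cast (u : ℤˣ) : |((u : ℤ) : ℝ)| = 1 := by
  rcases Int.units_eq_one_or u with h | h <;> simp [h]

theorem intUnit_cast_mul_self (u : ℤˣ) : ((u : ℤ) : ℝ) * ((u : ℤ) : ℝ) = 1 := by
  rcases Int.units_eq_one_or u with h | h <;> simp [h]

theorem card_signs (m : Type*) [Fintype m] [DecidableEq m] :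
    Fintype.card (m → ℤˣ) = 2 ^ Fintype.card m := by
  simp

/-- The involution of sign vectors flipping the `i`-th sign. -/
def flipSign {m : Type*} [DecidableEq m] (i : m) : (m → ℤˣ) ≃ (m → ℤˣ) := Equiv.mulLeft (Pi.mulSingle i (-1))

theorem flipSign_apply_self {m : Type*} [DecidableEq m] (i : m) (σ : m → ℤˣ) : flipSign i σ i = -σ i := by
  simp [flipSign]

theorem flipSign_apply_of_ne {m : Type*} [DecidableEq m] {i j : m} (h : j ≠ i) (σ : m → ℤˣ) : flipSign i σ j = σ j := by
  simp [flipSign, Pi.mulSingle_eq_of_ne h]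

/-! ### Contraction for averages over signs. -/

section Contraction

variable {ι m : Type*} [Fintype m]

theorem abs_signed_sum_le (σ : m → ℤˣ) (a B : m → ℝ) (h : ∀ i, |a i| ≤ B i) :
    |∑ i, ((σ i : ℤ) : ℝ) * a i| ≤ ∑ i, B i :=
  (Finset.abs_sum_le_sum_abs _ _).trans <| Finset.sum_le_sum fun i _ => by
    rw [abs_mul, abs_intUnit_cast, one_mul]; exact h i

theorem bddAbove_range_signed_sum (X : ι → m → ℝ) {B : m → ℝ} (hX : ∀ t i, |X t i| ≤ B i)
    (σ : m → ℤˣ) : BddAbove (Set.range fun t => ∑ i, ((σ i : ℤ) : ℝ) * X t i) := by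
  refine ⟨∑ i, B i, ?_⟩
  rintro _ ⟨t, rfl⟩
  exact (le_abs_self _).trans (abs_signed_sum_le σ _ _ (hX t))

/-- For competitors t, t' on the left, X t − X t' ≤ |Y t − Y t'|. The sign of Y t − Y t' decides
which of the two is used in the supremum with + on the right. -/
theorem iSup_add_sub_le_of_contraction [Nonempty ι] (b X Y : ι → ℝ)
    (h : ∀ t t', |X t - X t'| ≤ |Y t - Y t'|)
    (h₁ : BddAbove (Set.range fun t => b t + Y t)) (h₂ : BddAbove (Set.range fun t => b t - Y t)) :
    (⨆ t, (b t + X t)) + (⨆ t, (b t - X t)) ≤ (⨆ t, (b t + Y t)) + (⨆ t, (b t - Y t)) := by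
  refine ciSup_add_ciSup_le fun t t' => ?_
  have e := (le_abs_self _).trans (h t t')
  have a₁ := le_ciSup h₁ t
  have a₂ := le_ciSup h₂ t'
  have a₃ := le_ciSup h₁ t'
  have a₄ := le_ciSup h₂ t
  beta_reduce at a₁ a₂ a₃ a₄
  rcases le_total 0 (Y t - Y t') with h0 | h0
  · rw [abs_of_nonneg h0] at e; linarith
  · rw [abs_of_nonpos h0] at e; linarith

variable [DecidableEq m]

/-- Pairing each σ with its flip isolates the i-th sign, since all other signs agree within a pair.
-/
theorem sum_signs_eq_half_add_flip (i : m) (f : (m → ℤˣ) → ℝ) :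
    ∑ σ, f σ = (1 / 2 : ℝ) * ∑ σ, (f σ + f (flipSign i σ)) := by
  rw [Finset.sum_add_distrib, Equiv.sum_comp (flipSign i) f]; ring

theorem signed_sum_eq_erase_add (i : m) (σ : m → ℤˣ) (a : m → ℝ) :
    ∑ j, ((σ j : ℤ) : ℝ) * a j
      = (∑ j ∈ Finset.univ.erase i, ((σ j : ℤ) : ℝ) * a j) + ((σ i : ℤ) : ℝ) * a i :=
  (Finset.sum_erase_add _ _ (Finset.mem_univ i)).symm

theorem signed_sum_flip_eq_erase_sub (i : m) (σ : m → ℤˣ) (a : m → ℝ) :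
    ∑ j, ((flipSign i σ j : ℤ) : ℝ) * a j
      = (∑ j ∈ Finset.univ.erase i, ((σ j : ℤ) : ℝ) * a j) - ((σ i : ℤ) : ℝ) * a i := by
  rw [signed_sum_eq_erase_add i, flipSign_apply_self]
  have : ∑ j ∈ Finset.univ.erase i, ((flipSign i σ j : ℤ) : ℝ) * a j
      = ∑ j ∈ Finset.univ.erase i, ((σ j : ℤ) : ℝ) * a j :=
    Finset.sum_congr rfl fun j hj => by rw [flipSign_apply_of_ne (Finset.ne_of_mem_erase hj)]
  rw [this]; push_cast; ring

theorem sum_iSup_signed_le_of_contraction_at [Nonempty ι] (X Y : ι → m → ℝ) {B : m → ℝ}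
    (hY : ∀ t i, |Y t i| ≤ B i) (i : m) (hXY : ∀ t j, j ≠ i → X t j = Y t j)
    (h : ∀ t t', |X t i - X t' i| ≤ |Y t i - Y t' i|) :
    ∑ σ : m → ℤˣ, ⨆ t, ∑ j, ((σ j : ℤ) : ℝ) * X t j
      ≤ ∑ σ : m → ℤˣ, ⨆ t, ∑ j, ((σ j : ℤ) : ℝ) * Y t j := by
  rw [sum_signs_eq_half_add_flip i, sum_signs_eq_half_add_flip i (fun σ => ⨆ t, ∑ j, _)]
  refine mul_le_mul_of_nonneg_left (Finset.sum_le_sum fun σ _ => ?_) (by norm_num)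
  have b₁ := bddAbove_range_signed_sum Y hY σ
  have b₂ := bddAbove_range_signed_sum Y hY (flipSign i σ)
  simp only [signed_sum_flip_eq_erase_sub, signed_sum_eq_erase_add i σ] at b₁ b₂ ⊢
  have e : ∀ t, ∑ j ∈ Finset.univ.erase i, ((σ j : ℤ) : ℝ) * X t j
      = ∑ j ∈ Finset.univ.erase i, ((σ j : ℤ) : ℝ) * Y t j := fun t =>
    Finset.sum_congr rfl fun j hj => by rw [hXY t j (Finset.ne_of_mem_erase hj)]
  simp only [e]
  -- The other coordinates, common to X and Y, play the role of b; σ i is absorbed into the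
  -- functions, where it does not affect absolute differences.
  refine iSup_add_sub_le_of_contraction _ _ _ (fun t t' => ?_) b₁ b₂
  rw [← mul_sub, ← mul_sub, abs_mul, abs_mul, abs_intUnit_cast, one_mul, one_mul]
  exact h t t'

/-- The contraction principle of Ledoux and Talagrand for Rademacher averages. -/
theorem sum_iSup_signed_le_of_contraction [Nonempty ι] (X Y : ι → m → ℝ) {B C : m → ℝ}
    (hX : ∀ t i, |X t i| ≤ B i) (hY : ∀ t i, |Y t i| ≤ C i)
    (h : ∀ i t t', |X t i - X t' i| ≤ |Y t i - Y t' i|) :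
    ∑ σ : m → ℤˣ, ⨆ t, ∑ j, ((σ j : ℤ) : ℝ) * X t j
      ≤ ∑ σ : m → ℤˣ, ⨆ t, ∑ j, ((σ j : ℤ) : ℝ) * Y t j := by
  -- Interpolate: use X on A and Y elsewhere, and switch one coordinate at a time.
  suffices H : ∀ A : Finset m,
      ∑ σ : m → ℤˣ, ⨆ t, ∑ j, ((σ j : ℤ) : ℝ) * (if j ∈ A then X t j else Y t j)
        ≤ ∑ σ : m → ℤˣ, ⨆ t, ∑ j, ((σ j : ℤ) : ℝ) * Y t j by
    simpa using H Finset.univ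
  intro A
  induction A using Finset.induction_on with
  | empty => simp
  | insert i A hi ih =>
    refine le_trans (sum_iSup_signed_le_of_contraction_at
      (fun t j => if j ∈ insert i A then X t j else Y t j)
      (fun t j => if j ∈ A then X t j else Y t j) (B := fun j => max (B j) (C j))
      (fun t j => ?_) i (fun t j hj => ?_) fun t t' => ?_) ih
    · split_ifs
      · exact (hX t j).trans (le_max_left _ _)
      · exact (hY t j).trans (le_max_right _ _)
    · simp [hj]
    · simpa [hi] using h i t t'

end Contraction

/-! ### Signed sums of vectors and linear classes. -/

section Linear

variable {E m : Type*} [NormedAddCommGroup E] [InnerProductSpace ℝ E] [Fintype m] [DecidableEq m]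

/-- Signs are orthogonal: for i ≠ j, flipping the i-th sign negates the product. -/
theorem sum_signs_mul (i j : m) :
    ∑ σ : m → ℤˣ, ((σ i : ℤ) : ℝ) * ((σ j : ℤ) : ℝ) = if i = j then 2 ^ Fintype.card m else 0 := by
  split_ifs with h
  · subst h
    simp [intUnit_cast_mul_self]
  · rw [sum_signs_eq_half_add_flip i]
    simp only [flipSign_apply_self, flipSign_apply_of_ne (Ne.symm h)]
    simp

theorem sum_signs_norm_sq (x : m → E) :
    ∑ σ : m → ℤˣ, ‖∑ i, ((σ i : ℤ) : ℝ) • x i‖ ^ 2 = 2 ^ Fintype.card m * ∑ i, ‖x i‖ ^ 2 := by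
  have e : ∀ σ : m → ℤˣ, ‖∑ i, ((σ i : ℤ) : ℝ) • x i‖ ^ 2
      = ∑ i, ∑ j, (((σ i : ℤ) : ℝ) * ((σ j : ℤ) : ℝ)) * inner ℝ (x i) (x j) := fun σ => by
    rw [← real_inner_self_eq_norm_sq, sum_inner]
    refine Finset.sum_congr rfl fun i _ => ?_
    rw [inner_sum]
    refine Finset.sum_congr rfl fun j _ => ?_
    rw [real_inner_smul_left, real_inner_smul_right, mul_assoc]
  simp only [e]
  rw [Finset.sum_comm, Finset.mul_sum]
  refine Finset.sum_congr rfl fun i _ => ?_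
  rw [Finset.sum_comm]
  simp only [← Finset.sum_mul, sum_signs_mul]
  simp

/-- Cauchy–Schwarz over the sign vectors passes from the second moment, where the cross terms
vanish, to the first. -/
theorem sum_signs_norm_le (x : m → E) {R : ℝ} (hR : 0 ≤ R) (hx : ∀ i, ‖x i‖ ≤ R) :
    ∑ σ : m → ℤˣ, ‖∑ i, ((σ i : ℤ) : ℝ) • x i‖
      ≤ 2 ^ Fintype.card m * (R * √(Fintype.card m)) := by
  have h := sq_sum_le_card_mul_sum_sq (s := (Finset.univ : Finset (m → ℤˣ)))
    (f := fun σ => ‖∑ i, ((σ i : ℤ) : ℝ) • x i‖)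
  rw [sum_signs_norm_sq, Finset.card_univ, card_signs] at h
  push_cast at h
  have h2 : ∑ i, ‖x i‖ ^ 2 ≤ Fintype.card m * R ^ 2 := by
    calc ∑ i, ‖x i‖ ^ 2 ≤ ∑ _i : m, R ^ 2 :=
          Finset.sum_le_sum fun i _ => pow_le_pow_left₀ (norm_nonneg _) (hx i) 2
      _ = _ := by simp
  refine le_of_sq_le_sq ?_ (by positivity)
  refine h.trans ?_
  rw [mul_pow, mul_pow, Real.sq_sqrt (by positivity), pow_two, mul_assoc, ← mul_assoc]
  rw [mul_assoc]
  gcongr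
  linarith

theorem sum_iSup_signed_inner_le (x : m → E) {R Λ : ℝ} (hR : 0 ≤ R) (hΛ : 0 ≤ Λ)
    (hx : ∀ i, ‖x i‖ ≤ R) :
    ∑ σ : m → ℤˣ, ⨆ w : Metric.closedBall (0 : E) Λ,
        ∑ i, ((σ i : ℤ) : ℝ) * inner ℝ (w : E) (x i)
      ≤ 2 ^ Fintype.card m * (Λ * (R * √(Fintype.card m))) := by
  have : Nonempty (Metric.closedBall (0 : E) Λ) := ⟨⟨0, by simpa using hΛ⟩⟩
  calc _ ≤ ∑ σ : m → ℤˣ, Λ * ‖∑ i, ((σ i : ℤ) : ℝ) • x i‖ := by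
        refine Finset.sum_le_sum fun σ _ => ciSup_le fun w => ?_
        have e : ∑ i, ((σ i : ℤ) : ℝ) * inner ℝ (w : E) (x i)
            = inner ℝ (w : E) (∑ i, ((σ i : ℤ) : ℝ) • x i) := by
          rw [inner_sum]
          exact Finset.sum_congr rfl fun i _ => (real_inner_smul_right _ _ _).symm
        rw [e]
        refine (real_inner_le_norm _ _).trans ?_
        gcongr
        exact mem_closedBall_zero_iff.1 w.2
    _ = Λ * ∑ σ : m → ℤˣ, ‖∑ i, ((σ i : ℤ) : ℝ) • x i‖ := by rw [Finset.mul_sum]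
    _ ≤ Λ * (2 ^ Fintype.card m * (R * √(Fintype.card m))) := by
        gcongr; exact sum_signs_norm_le x hR hx
    _ = _ := by ring

end Linear

/-! ### Calculus of empirical Rademacher complexities. -/

section Empirical

variable {Z : Type*} {n : ℕ}

theorem empRademacher_range_eq_mul {ι : Type*} (g : ι → Z → ℝ) (S : Fin n → Z) :
    empRademacher (Set.range g) S
      = (1 / 2 ^ n : ℝ) * ((1 / n : ℝ) *
        ∑ σ : Fin n → ℤˣ, ⨆ t, ∑ i, ((σ i : ℤ) : ℝ) * g t (S i)) := by
  rw [empRademacher_range]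
  congr 1
  rw [Finset.mul_sum]
  refine Finset.sum_congr rfl fun σ _ => ?_
  rw [Real.mul_iSup_of_nonneg (by positivity)]

/-- The comparison is made at each sample point separately, so the Lipschitz map relating g to h may
depend on the label. -/
theorem empRademacher_range_le_of_contraction {ι : Type*} [Nonempty ι] {g h : ι → Z → ℝ}
    {S : Fin n → Z} {B C : Fin n → ℝ} (hg : ∀ t i, |g t (S i)| ≤ B i)
    (hh : ∀ t i, |h t (S i)| ≤ C i)
    (hgh : ∀ i t t', |g t (S i) - g t' (S i)| ≤ |h t (S i) - h t' (S i)|) :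
    empRademacher (Set.range g) S ≤ empRademacher (Set.range h) S := by
  rw [empRademacher_range_eq_mul, empRademacher_range_eq_mul]
  refine mul_le_mul_of_nonneg_left (mul_le_mul_of_nonneg_left ?_ (by positivity)) (by positivity)
  exact sum_iSup_signed_le_of_contraction (fun t i => g t (S i)) (fun t i => h t (S i)) hg hh hgh

theorem empRademacher_const_smul_range {ι : Type*} {c : ℝ} (hc : 0 ≤ c) (g : ι → Z → ℝ)
    (S : Fin n → Z) :
    empRademacher (Set.range fun t z => c * g t z) S = c * empRademacher (Set.range g) S := by
  rw [empRademacher_range_eq_mul, empRademacher_range_eq_mul]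
  have e : ∀ σ : Fin n → ℤˣ, ⨆ t, ∑ i, ((σ i : ℤ) : ℝ) * (c * g t (S i))
      = c * ⨆ t, ∑ i, ((σ i : ℤ) : ℝ) * g t (S i) := fun σ => by
    rw [Real.mul_iSup_of_nonneg hc]
    congr 1; ext t; rw [Finset.mul_sum]
    exact Finset.sum_congr rfl fun i _ => by ring
  simp only [e, ← Finset.mul_sum]
  ring

/-- A real `⨆` is 0 on an unbounded family, so comparisons of suprema need this bound. -/
theorem bddAbove_signed_mean (F : Set (Z → ℝ)) {S : Fin n → Z} {B : Fin n → ℝ}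
    (hF : ∀ f ∈ F, ∀ i, |f (S i)| ≤ B i) (σ : Fin n → ℤˣ) :
    BddAbove (Set.range fun f : F => (1 / n : ℝ) * ∑ i, ((σ i : ℤ) : ℝ) * (f : Z → ℝ) (S i)) := by
  refine ⟨(1 / n : ℝ) * ∑ i, B i, ?_⟩
  rintro _ ⟨f, rfl⟩
  refine mul_le_mul_of_nonneg_left ?_ (by positivity)
  exact (le_abs_self _).trans (abs_signed_sum_le σ _ _ fun i => hF f f.2 i)

theorem abs_empRademacher_le {F : Set (Z → ℝ)} {S : Fin n → Z} {B : ℝ} (hn : 1 ≤ n)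
    (hne : F.Nonempty) (hF : ∀ f ∈ F, ∀ i, |f (S i)| ≤ B) : |empRademacher F S| ≤ B := by
  have : Nonempty F := hne.to_subtype
  have hn0 : (n : ℝ) ≠ 0 := by positivity
  have key : ∀ (σ : Fin n → ℤˣ) (f : F),
      |(1 / n : ℝ) * ∑ i, ((σ i : ℤ) : ℝ) * (f : Z → ℝ) (S i)| ≤ B := fun σ f => by
    rw [abs_mul, abs_of_nonneg (by positivity : (0 : ℝ) ≤ 1 / n)]
    calc _ ≤ (1 / n : ℝ) * ∑ _i : Fin n, B := by
          gcongr; exact abs_signed_sum_le σ _ _ fun i => hF f f.2 i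
      _ = B := by simp; field_simp
  unfold empRademacher
  rw [abs_mul, abs_of_nonneg (by positivity : (0 : ℝ) ≤ 1 / 2 ^ n)]
  calc _ ≤ (1 / 2 ^ n : ℝ) * ∑ _σ : Fin n → ℤˣ, B := by
        gcongr
        refine (Finset.abs_sum_le_sum_abs _ _).trans (Finset.sum_le_sum fun σ _ => ?_)
        obtain ⟨f⟩ := ‹Nonempty F›
        refine abs_le.2 ⟨?_, ciSup_le fun f => (abs_le.1 (key σ f)).2⟩
        exact (abs_le.1 (key σ f)).1.trans (le_ciSup (bddAbove_signed_mean F hF σ) f)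
    _ = B := by simp

theorem empRademacher_mono {F G : Set (Z → ℝ)} {S : Fin n → Z} {B : Fin n → ℝ}
    (hne : F.Nonempty) (hFG : F ⊆ G) (hG : ∀ f ∈ G, ∀ i, |f (S i)| ≤ B i) :
    empRademacher F S ≤ empRademacher G S := by
  have : Nonempty F := hne.to_subtype
  unfold empRademacher
  gcongr with σ
  exact ciSup_le fun f => le_ciSup (bddAbove_signed_mean G hG σ) ⟨f, hFG f.2⟩

theorem empRademacher_minkowskiSum_le {k : ℕ} {F : Fin k → Set (Z → ℝ)} {S : Fin n → Z}
    {B : Fin n → ℝ} (hne : ∀ j, (F j).Nonempty) (hF : ∀ j, ∀ f ∈ F j, ∀ i, |f (S i)| ≤ B i) :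
    empRademacher (minkowskiSum F) S ≤ ∑ j, empRademacher (F j) S := by
  have : Nonempty (minkowskiSum F) :=
    ⟨⟨_, fun j => (hne j).some, fun j => (hne j).some_mem, rfl⟩⟩
  unfold empRademacher
  rw [← Finset.mul_sum, Finset.sum_comm]
  gcongr with σ
  refine ciSup_le ?_
  rintro ⟨_, f, hf, rfl⟩
  calc _ = ∑ j, (1 / n : ℝ) * ∑ i, ((σ i : ℤ) : ℝ) * f j (S i) := by
        simp only [Finset.mul_sum]
        exact Finset.sum_comm
    _ ≤ _ := Finset.sum_le_sum fun j _ =>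
        le_ciSup (bddAbove_signed_mean (F j) (hF j) σ) ⟨f j, hf j⟩

end Empirical

/-! ### McDiarmid's inequality. -/

section BoundedDifferences

variable {Z : Type*} [MeasurableSpace Z]

theorem integrable_of_measurable_of_abs_le {Ω : Type*} [MeasurableSpace Ω] {μ : Measure Ω}
    [IsFiniteMeasure μ] {f : Ω → ℝ} (hf : Measurable f) {B : ℝ} (hB : ∀ ω, |f ω| ≤ B) :
    Integrable f μ :=
  Integrable.of_bound hf.aestronglyMeasurable B (Filter.Eventually.of_forall hB)

theorem abs_integral_le_of_abs_le {Ω : Type*} [MeasurableSpace Ω] {μ : Measure Ω}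
    [IsProbabilityMeasure μ] {f : Ω → ℝ} {B : ℝ} (hB : ∀ ω, |f ω| ≤ B) : |∫ ω, f ω ∂μ| ≤ B := by
  have := norm_integral_le_of_norm_le_const (μ := μ) (f := f) (C := B) (Filter.Eventually.of_forall hB)
  simpa using this

theorem measurable_finCons (n : ℕ) :
    Measurable fun p : Z × (Fin n → Z) => (Fin.cons p.1 p.2 : Fin (n + 1) → Z) := by
  refine measurable_pi_lambda _ fun i => ?_
  refine Fin.cases ?_ (fun j => ?_) i
  · simpa using measurable_fst
  · exact (measurable_pi_apply j).comp measurable_snd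

theorem integral_pi_succ (P : Measure Z) [IsProbabilityMeasure P] {n : ℕ}
    {f : (Fin (n + 1) → Z) → ℝ} (hf : Measurable f) {B : ℝ} (hB : ∀ S, |f S| ≤ B) :
    ∫ S, f S ∂(Measure.pi fun _ => P)
      = ∫ S, ∫ z, f (Fin.cons z S) ∂P ∂(Measure.pi fun _ : Fin n => P) := by
  have e := (measurePreserving_piFinSuccAbove (fun _ : Fin (n + 1) => P) 0).symm
  rw [← e.integral_comp' f]
  rw [integral_prod_symm]
  · refine integral_congr_ae (Filter.Eventually.of_forall fun S => ?_)
    refine integral_congr_ae (Filter.Eventually.of_forall fun z => ?_)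
    rw [MeasurableEquiv.piFinSuccAbove_symm_apply]
    exact congrArg f (Fin.insertNth_zero' z S)
  · exact integrable_of_measurable_of_abs_le (hf.comp (MeasurableEquiv.measurable _))
      fun p => hB _

/-- Hoeffding's lemma for a function of oscillation at most `c`. -/
theorem integral_exp_le_of_oscillation_le (P : Measure Z) [IsProbabilityMeasure P] {X : Z → ℝ}
    (hX : Measurable X) {B c : ℝ} (hB : ∀ z, |X z| ≤ B) (h : ∀ z z', X z - X z' ≤ c) (t : ℝ) :
    ∫ z, Real.exp (t * (X z - ∫ z', X z' ∂P)) ∂P ≤ Real.exp (c ^ 2 / 4 * t ^ 2 / 2) := by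
  have hne : Nonempty Z := nonempty_of_isProbabilityMeasure P
  have hbd : BddBelow (Set.range X) := ⟨-B, by rintro _ ⟨z, rfl⟩; exact (abs_le.1 (hB z)).1⟩
  -- X lies in an interval of length c starting at its infimum, whence the variance proxy (c/2)².
  have key := ProbabilityTheory.hasSubgaussianMGF_of_mem_Icc (μ := P) (a := ⨅ z, X z)
    (b := (⨅ z, X z) + c) hX.aemeasurable (Filter.Eventually.of_forall fun z =>
      ⟨ciInf_le hbd z, by
        have : X z - c ≤ ⨅ z, X z := le_ciInf fun z' => by linarith [h z z']
        linarith⟩)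
  refine (key.mgf_le t).trans (le_of_eq ?_)
  congr 1
  push_cast
  rw [add_sub_cancel_left, Real.norm_eq_abs, div_pow, sq_abs]
  norm_num

/-- The martingale argument as an induction on n: averaging out the first point leaves a function g
with the same mean and bounded differences, and costs one Hoeffding factor. -/
theorem integral_exp_le_of_boundedDifferences (P : Measure Z) [IsProbabilityMeasure P] {B c : ℝ}
    (t : ℝ) : ∀ (n : ℕ) (f : (Fin n → Z) → ℝ), Measurable f → (∀ S, |f S| ≤ B) →
      (∀ S i z, |f (Function.update S i z) - f S| ≤ c) →
      ∫ S, Real.exp (t * (f S - ∫ S', f S' ∂(Measure.pi fun _ => P))) ∂(Measure.pi fun _ => P)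
        ≤ Real.exp (n * (c ^ 2 / 4) * t ^ 2 / 2) := by
  intro n
  induction n with
  | zero =>
    intro f _ _ _
    have e : ∀ S : Fin 0 → Z, f S = f default := fun S => congrArg f (Subsingleton.elim _ _)
    simp only [e]
    simp
  | succ n ih =>
    intro f hf hB h
    set m := ∫ S, f S ∂(Measure.pi fun _ => P) with hm
    have hmB : |m| ≤ B := abs_integral_le_of_abs_le hB
    set g : (Fin n → Z) → ℝ := fun S => ∫ z, f (Fin.cons z S) ∂P with hg
    have hfc : ∀ S : Fin n → Z, Measurable fun z => f (Fin.cons z S) := fun S =>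
      hf.comp ((measurable_finCons n).comp (measurable_id.prodMk measurable_const))
    have hgm : Measurable g := by
      have : StronglyMeasurable fun p : (Fin n → Z) × Z => f (Fin.cons p.2 p.1) :=
        (hf.comp ((measurable_finCons n).comp measurable_swap)).stronglyMeasurable
      exact this.integral_prod_right'.measurable
    have hgB : ∀ S, |g S| ≤ B := fun S => abs_integral_le_of_abs_le fun z => hB _
    have hgd : ∀ S i z, |g (Function.update S i z) - g S| ≤ c := fun S i z => by
      rw [hg]
      beta_reduce
      rw [← integral_sub (integrable_of_measurable_of_abs_le (hfc _) fun z => hB _)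
        (integrable_of_measurable_of_abs_le (hfc _) fun z => hB _)]
      refine abs_integral_le_of_abs_le fun z' => ?_
      rw [Fin.cons_update]
      exact h _ _ _
    have hgint : ∫ S, g S ∂(Measure.pi fun _ => P) = m := (integral_pi_succ P hf hB).symm
    have hexpB : ∀ x y : ℝ, |x| ≤ B → |y| ≤ B →
        |Real.exp (t * (x - y))| ≤ Real.exp (|t| * (B + B)) := fun x y hx hy => by
      rw [Real.abs_exp]
      refine Real.exp_le_exp.2 ((le_abs_self _).trans ?_)
      rw [abs_mul]
      exact mul_le_mul_of_nonneg_left ((abs_sub _ _).trans (add_le_add hx hy)) (abs_nonneg _)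
    rw [integral_pi_succ P (f := fun S => Real.exp (t * (f S - m))) (B := Real.exp (|t| * (B + B)))
      (Real.measurable_exp.comp ((hf.sub_const m).const_mul t)) fun S => hexpB _ _ (hB S) hmB]
    have hstep : ∀ S : Fin n → Z, ∫ z, Real.exp (t * (f (Fin.cons z S) - m)) ∂P
        ≤ Real.exp (c ^ 2 / 4 * t ^ 2 / 2) * Real.exp (t * (g S - m)) := fun S => by
      -- With S fixed, g S is the mean of f over the first point, so Hoeffding's lemma applies to
      -- the first factor and the second is constant.
      have e : ∀ z, Real.exp (t * (f (Fin.cons z S) - m))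
          = Real.exp (t * (f (Fin.cons z S) - g S)) * Real.exp (t * (g S - m)) := fun z => by
        rw [← Real.exp_add]; congr 1; ring
      simp only [e]
      rw [integral_mul_const]
      refine mul_le_mul_of_nonneg_right ?_ (Real.exp_nonneg _)
      refine integral_exp_le_of_oscillation_le P (hfc S) (fun z => hB _) (fun z z' => ?_) t
      have := h (Fin.cons z' S) 0 z
      rw [Fin.update_cons_zero] at this
      exact (le_abs_self _).trans this
    have hi₁ : Integrable (fun S : Fin n → Z => ∫ z, Real.exp (t * (f (Fin.cons z S) - m)) ∂P)
        (Measure.pi fun _ => P) := by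
      refine integrable_of_measurable_of_abs_le (B := Real.exp (|t| * (B + B))) ?_
        fun S => abs_integral_le_of_abs_le fun z => hexpB _ _ (hB _) hmB
      have : StronglyMeasurable fun p : (Fin n → Z) × Z =>
          Real.exp (t * (f (Fin.cons p.2 p.1) - m)) :=
        (Real.measurable_exp.comp (((hf.comp ((measurable_finCons n).comp
          measurable_swap)).sub_const m).const_mul t)).stronglyMeasurable
      exact this.integral_prod_right'.measurable
    have hi₂ : Integrable (fun S : Fin n → Z => Real.exp (t * (g S - m)))
        (Measure.pi fun _ => P) :=
      integrable_of_measurable_of_abs_le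
        (Real.measurable_exp.comp ((hgm.sub_const m).const_mul t)) fun S => hexpB _ _ (hgB S) hmB
    refine (integral_mono hi₁ (hi₂.const_mul _) hstep).trans ?_
    rw [integral_const_mul]
    have := ih g hgm hgB hgd
    rw [hgint] at this
    refine (mul_le_mul_of_nonneg_left this (Real.exp_nonneg _)).trans (le_of_eq ?_)
    rw [← Real.exp_add]; congr 1; push_cast; ring

/-- McDiarmid's bounded differences inequality. -/
theorem measureReal_ge_le_of_boundedDifferences (P : Measure Z) [IsProbabilityMeasure P] {n : ℕ}
    {f : (Fin n → Z) → ℝ} (hf : Measurable f) {B c : ℝ} (hB : ∀ S, |f S| ≤ B)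
    (h : ∀ S i z, |f (Function.update S i z) - f S| ≤ c) {ε : ℝ} (hε : 0 ≤ ε) :
    (Measure.pi fun _ => P).real {S | ε ≤ f S - ∫ S', f S' ∂(Measure.pi fun _ => P)}
      ≤ Real.exp (-ε ^ 2 / (2 * (n * (c ^ 2 / 4)))) := by
  have key : ProbabilityTheory.HasSubgaussianMGF
      (fun S => f S - ∫ S', f S' ∂(Measure.pi fun _ => P)) ⟨n * (c ^ 2 / 4), by positivity⟩
      (Measure.pi fun _ => P) := by
    refine ⟨fun t => ?_, fun t => integral_exp_le_of_boundedDifferences P t n f hf hB h⟩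
    refine integrable_of_measurable_of_abs_le (B := Real.exp (|t| * (B + B)))
      (Real.measurable_exp.comp ((hf.sub_const _).const_mul t)) fun S => ?_
    rw [Real.abs_exp]
    refine Real.exp_le_exp.2 ((le_abs_self _).trans ?_)
    rw [abs_mul]
    exact mul_le_mul_of_nonneg_left
      ((abs_sub _ _).trans (add_le_add (hB S) (abs_integral_le_of_abs_le hB))) (abs_nonneg _)
  exact key.measure_ge_le hε

end BoundedDifferences

/-! ### Measurability of suprema. -/

section Measurability

variable {Z : Type*} [TopologicalSpace Z] [SecondCountableTopology Z] [MeasurableSpace Z]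
  [BorelSpace Z] {n : ℕ}

/-- The family may be uncountable; continuity makes its supremum lower semicontinuous, hence Borel.
-/
theorem measurable_iSup_of_continuous {Ω ι : Type*} [TopologicalSpace Ω] [MeasurableSpace Ω]
    [OpensMeasurableSpace Ω] {f : ι → Ω → ℝ} (hf : ∀ t, Continuous (f t))
    (hb : ∀ ω, BddAbove (Set.range fun t => f t ω)) : Measurable fun ω => ⨆ t, f t ω :=
  (lowerSemicontinuous_ciSup hb fun t => (hf t).lowerSemicontinuous).measurable

theorem measurable_empRademacher {F : Set (Z → ℝ)} (hF : ∀ f ∈ F, Continuous f) {B : Z → ℝ}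
    (hb : ∀ f ∈ F, ∀ z, |f z| ≤ B z) : Measurable fun S : Fin n → Z => empRademacher F S := by
  unfold empRademacher
  refine (Finset.measurable_sum _ fun σ _ => ?_).const_mul _
  refine measurable_iSup_of_continuous (fun f => ?_) fun S =>
    bddAbove_signed_mean F (B := fun i => B (S i)) (fun f hf i => hb f hf (S i)) σ
  have := hF f f.2
  fun_prop

/-- The pointwise bound B keeps all suprema finite, for measurability; the almost sure bound C gives
integrability. -/
theorem integrable_empRademacher (hn : 1 ≤ n) (P : Measure Z) [IsProbabilityMeasure P]
    {F : Set (Z → ℝ)} (hne : F.Nonempty) (hF : ∀ f ∈ F, Continuous f) {B : Z → ℝ}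
    (hb : ∀ f ∈ F, ∀ z, |f z| ≤ B z) {C : ℝ} (hC : ∀ᵐ z ∂P, B z ≤ C) :
    Integrable (fun S : Fin n → Z => empRademacher F S) (Measure.pi fun _ => P) := by
  refine Integrable.of_bound (measurable_empRademacher hF hb).aestronglyMeasurable C ?_
  have h : ∀ᵐ S : Fin n → Z ∂(Measure.pi fun _ => P), ∀ i, B (S i) ≤ C :=
    ae_all_iff.2 fun i => (Measure.tendsto_eval_ae_ae (μ := fun _ : Fin n => P) (i := i)).eventually hC
  filter_upwards [h] with S hS
  exact abs_empRademacher_le hn hne fun f hf i => (hb f hf (S i)).trans (hS i)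

end Measurability

/-! ### Symmetrization and the generalization bound. -/

section Generalization

theorem mean_mem_Icc {n : ℕ} (hn : 1 ≤ n) {a : Fin n → ℝ} (h0 : ∀ i, 0 ≤ a i) (h1 : ∀ i, a i ≤ 1) :
    0 ≤ (1 / n : ℝ) * ∑ i, a i ∧ (1 / n : ℝ) * ∑ i, a i ≤ 1 := by
  have hn0 : (0 : ℝ) < n := by exact_mod_cast hn
  refine ⟨mul_nonneg (by positivity) (Finset.sum_nonneg fun i _ => h0 i), ?_⟩
  calc (1 / n : ℝ) * ∑ i, a i ≤ (1 / n : ℝ) * ∑ _i : Fin n, (1 : ℝ) := by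
        gcongr with i; exact h1 i
    _ = 1 := by simp; field_simp

variable {Z ι : Type*} {n : ℕ}

/-- The supremum of the signed mean differences on a sample and a ghost sample. -/
noncomputable def signedGap (g : ι → Z → ℝ) (σ : Fin n → ℤˣ) (p : (Fin n → Z) × (Fin n → Z)) : ℝ :=
  ⨆ t, (1 / n : ℝ) * ∑ i, ((σ i : ℤ) : ℝ) * (g t (p.2 i) - g t (p.1 i))

/-- Exchange the sample and the ghost sample at the coordinates with a negative sign. -/
def signedSwap (σ : Fin n → ℤˣ) (p : (Fin n → Z) × (Fin n → Z)) : (Fin n → Z) × (Fin n → Z) :=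
  (fun i => if σ i = 1 then p.1 i else p.2 i, fun i => if σ i = 1 then p.2 i else p.1 i)

theorem signedGap_one_signedSwap (g : ι → Z → ℝ) (σ : Fin n → ℤˣ)
    (p : (Fin n → Z) × (Fin n → Z)) : signedGap g 1 (signedSwap σ p) = signedGap g σ p := by
  unfold signedGap
  congr 1; ext t; congr 1
  refine Finset.sum_congr rfl fun i _ => ?_
  rcases Int.units_eq_one_or (σ i) with h | h <;> simp [signedSwap, h]

theorem abs_signed_mean_diff_le (hn : 1 ≤ n) {g : ι → Z → ℝ} (h0 : ∀ t z, 0 ≤ g t z)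
    (h1 : ∀ t z, g t z ≤ 1) (σ : Fin n → ℤˣ) (p : (Fin n → Z) × (Fin n → Z)) (t : ι) :
    |(1 / n : ℝ) * ∑ i, ((σ i : ℤ) : ℝ) * (g t (p.2 i) - g t (p.1 i))| ≤ 1 := by
  have hn0 : (0 : ℝ) < n := by exact_mod_cast hn
  rw [abs_mul, abs_of_nonneg (by positivity : (0 : ℝ) ≤ 1 / n)]
  calc _ ≤ (1 / n : ℝ) * ∑ _i : Fin n, (1 : ℝ) := by
        refine mul_le_mul_of_nonneg_left (abs_signed_sum_le σ _ _ fun i => ?_) (by positivity)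
        rw [abs_le]
        constructor <;> linarith [h0 t (p.2 i), h0 t (p.1 i), h1 t (p.2 i), h1 t (p.1 i)]
    _ = 1 := by simp; field_simp

theorem bddAbove_signed_mean_diff (hn : 1 ≤ n) {g : ι → Z → ℝ} (h0 : ∀ t z, 0 ≤ g t z)
    (h1 : ∀ t z, g t z ≤ 1) (σ : Fin n → ℤˣ) (p : (Fin n → Z) × (Fin n → Z)) :
    BddAbove (Set.range fun t =>
      (1 / n : ℝ) * ∑ i, ((σ i : ℤ) : ℝ) * (g t (p.2 i) - g t (p.1 i))) := by
  refine ⟨1, ?_⟩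
  rintro _ ⟨t, rfl⟩
  exact (abs_le.1 (abs_signed_mean_diff_le hn h0 h1 σ p t)).2

theorem abs_iSup_le_of_abs_le [Nonempty ι] {a : ι → ℝ} {B : ℝ} (h : ∀ t, |a t| ≤ B) :
    |⨆ t, a t| ≤ B := by
  obtain ⟨t⟩ := ‹Nonempty ι›
  have : Nonempty ι := ⟨t⟩
  refine abs_le.2 ⟨(abs_le.1 (h t)).1.trans (le_ciSup (f := a) ⟨B, ?_⟩ t),
    ciSup_le fun t => (abs_le.1 (h t)).2⟩
  rintro _ ⟨t, rfl⟩
  exact (abs_le.1 (h t)).2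

theorem abs_signedGap_le [Nonempty ι] (hn : 1 ≤ n) {g : ι → Z → ℝ} (h0 : ∀ t z, 0 ≤ g t z)
    (h1 : ∀ t z, g t z ≤ 1) (σ : Fin n → ℤˣ) (p : (Fin n → Z) × (Fin n → Z)) :
    |signedGap g σ p| ≤ 1 :=
  abs_iSup_le_of_abs_le (abs_signed_mean_diff_le hn h0 h1 σ p)

/-- The supremum of a difference splits into two; the half with −σ is reindexed by σ ↦ −σ. -/
theorem mean_signedGap_le [Nonempty ι] {g : ι → Z → ℝ} (h0 : ∀ t z, 0 ≤ g t z)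
    (h1 : ∀ t z, g t z ≤ 1) (p : (Fin n → Z) × (Fin n → Z)) :
    (1 / 2 ^ n : ℝ) * ∑ σ : Fin n → ℤˣ, signedGap g σ p
      ≤ empRademacher (Set.range g) p.1 + empRademacher (Set.range g) p.2 := by
  rw [empRademacher_range, empRademacher_range, ← mul_add,
    ← Equiv.sum_comp (Equiv.neg (Fin n → ℤˣ))
      (fun σ => ⨆ t, (1 / n : ℝ) * ∑ i, ((σ i : ℤ) : ℝ) * g t (p.1 i)),
    ← Finset.sum_add_distrib]
  have hb : ∀ (σ : Fin n → ℤˣ) (S : Fin n → Z),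
      BddAbove (Set.range fun t => (1 / n : ℝ) * ∑ i, ((σ i : ℤ) : ℝ) * g t (S i)) := fun σ S => by
    refine ⟨(1 / n : ℝ) * ∑ _i : Fin n, (1 : ℝ), ?_⟩
    rintro _ ⟨t, rfl⟩
    refine mul_le_mul_of_nonneg_left ?_ (by positivity)
    exact (le_abs_self _).trans (abs_signed_sum_le σ _ _ fun i =>
      abs_le.2 ⟨by linarith [h0 t (S i)], h1 t (S i)⟩)
  refine mul_le_mul_of_nonneg_left (Finset.sum_le_sum fun σ _ => ciSup_le fun t => ?_)
    (by positivity)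
  refine le_trans (le_of_eq ?_) (add_le_add (le_ciSup (hb (-σ) p.1) t) (le_ciSup (hb σ p.2) t))
  rw [← mul_add, ← Finset.sum_add_distrib]
  congr 1
  refine Finset.sum_congr rfl fun i _ => ?_
  simp only [Pi.neg_apply, Units.val_neg, Int.cast_neg]
  ring

variable [MeasurableSpace Z]

/-- The uniform deviation of the expectations of the functions `g t` from their sample means. -/
noncomputable def uniformDeviation (P : Measure Z) (g : ι → Z → ℝ) (S : Fin n → Z) : ℝ :=
  ⨆ t, (∫ z, g t z ∂P - (1 / n : ℝ) * ∑ i, g t (S i))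

theorem measurePreserving_signedSwap (P : Measure Z) [IsProbabilityMeasure P] (σ : Fin n → ℤˣ) :
    MeasurePreserving (signedSwap (Z := Z) σ)
      ((Measure.pi fun _ => P).prod (Measure.pi fun _ => P))
      ((Measure.pi fun _ => P).prod (Measure.pi fun _ => P)) := by
  -- Viewed as a sample of pairs, the two samples are swapped coordinatewise, and each swap
  -- preserves P × P.
  have e := measurePreserving_arrowProdEquivProdArrow Z Z (Fin n) (fun _ => P) (fun _ => P)
  have s : MeasurePreserving
      (fun (T : Fin n → Z × Z) i => (if σ i = 1 then id else Prod.swap) (T i))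
      (Measure.pi fun _ => P.prod P) (Measure.pi fun _ => P.prod P) := by
    refine measurePreserving_pi (fun _ => P.prod P) (fun _ => P.prod P)
      (f := fun i => if σ i = 1 then id else Prod.swap) fun i => ?_
    split_ifs
    · exact MeasurePreserving.id _
    · exact Measure.measurePreserving_swap
  convert (e.comp s).comp e.symm using 1
  ext p i <;> by_cases h : σ i = 1 <;>
    simp [signedSwap, h, MeasurableEquiv.arrowProdEquivProdArrow,
      Equiv.arrowProdEquivProdArrow]

theorem abs_deviation_le (hn : 1 ≤ n) (P : Measure Z) [IsProbabilityMeasure P] {g : ι → Z → ℝ}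
    (h0 : ∀ t z, 0 ≤ g t z) (h1 : ∀ t z, g t z ≤ 1) (S : Fin n → Z) (t : ι) :
    |∫ z, g t z ∂P - (1 / n : ℝ) * ∑ i, g t (S i)| ≤ 1 := by
  have hm := mean_mem_Icc hn (fun i => h0 t (S i)) (fun i => h1 t (S i))
  have hi0 : 0 ≤ ∫ z, g t z ∂P := integral_nonneg (h0 t)
  have hi1 : ∫ z, g t z ∂P ≤ 1 := (abs_le.1 (abs_integral_le_of_abs_le fun z =>
    abs_le.2 ⟨by linarith [h0 t z], h1 t z⟩)).2
  rw [abs_le]; constructor <;> linarith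

theorem bddAbove_deviation (hn : 1 ≤ n) (P : Measure Z) [IsProbabilityMeasure P] {g : ι → Z → ℝ}
    (h0 : ∀ t z, 0 ≤ g t z) (h1 : ∀ t z, g t z ≤ 1) (S : Fin n → Z) :
    BddAbove (Set.range fun t => ∫ z, g t z ∂P - (1 / n : ℝ) * ∑ i, g t (S i)) := by
  refine ⟨1, ?_⟩
  rintro _ ⟨t, rfl⟩
  exact (abs_le.1 (abs_deviation_le hn P h0 h1 S t)).2

theorem uniformDeviation_update_le [Nonempty ι] (hn : 1 ≤ n) (P : Measure Z)
    [IsProbabilityMeasure P] {g : ι → Z → ℝ} (h0 : ∀ t z, 0 ≤ g t z) (h1 : ∀ t z, g t z ≤ 1)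
    (S : Fin n → Z) (i : Fin n) (z : Z) :
    uniformDeviation P g (Function.update S i z) ≤ uniformDeviation P g S + 1 / n := by
  refine ciSup_le fun t => ?_
  have hle : ∫ z, g t z ∂P - (1 / n : ℝ) * ∑ i, g t (S i) ≤ uniformDeviation P g S :=
    le_ciSup (bddAbove_deviation hn P h0 h1 S) t
  have hs : ∑ j, g t (S j) - ∑ j, g t (Function.update S i z j) = g t (S i) - g t z := by
    rw [← Finset.sum_sub_distrib, Finset.sum_eq_single i]
    · simp
    · intro j _ hj; simp [hj]
    · simp
  have hd : (1 / n : ℝ) * ∑ j, g t (S j) - (1 / n : ℝ) * ∑ j, g t (Function.update S i z j)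
      ≤ 1 / n := by
    rw [← mul_sub, hs]
    exact mul_le_of_le_one_right (by positivity) (by linarith [h0 t z, h1 t (S i)])
  linarith

theorem abs_uniformDeviation_update_sub_le [Nonempty ι] (hn : 1 ≤ n) (P : Measure Z)
    [IsProbabilityMeasure P] {g : ι → Z → ℝ} (h0 : ∀ t z, 0 ≤ g t z) (h1 : ∀ t z, g t z ≤ 1)
    (S : Fin n → Z) (i : Fin n) (z : Z) :
    |uniformDeviation P g (Function.update S i z) - uniformDeviation P g S| ≤ 1 / n := by
  have a := uniformDeviation_update_le hn P h0 h1 S i z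
  -- The reverse inequality comes from putting the original point back.
  have b := uniformDeviation_update_le hn P h0 h1 (Function.update S i z) i (S i)
  rw [Function.update_idem, Function.update_eq_self] at b
  rw [abs_le]; constructor <;> linarith

variable [TopologicalSpace Z] [SecondCountableTopology Z] [BorelSpace Z]

theorem measurable_uniformDeviation (hn : 1 ≤ n) (P : Measure Z) [IsProbabilityMeasure P]
    {g : ι → Z → ℝ} (hg : ∀ t, Continuous (g t)) (h0 : ∀ t z, 0 ≤ g t z) (h1 : ∀ t z, g t z ≤ 1) :
    Measurable (uniformDeviation P g : (Fin n → Z) → ℝ) := by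
  refine measurable_iSup_of_continuous (fun t => ?_) (bddAbove_deviation hn P h0 h1)
  have := hg t
  fun_prop

theorem measurable_signedGap (hn : 1 ≤ n) {g : ι → Z → ℝ} (hg : ∀ t, Continuous (g t))
    (h0 : ∀ t z, 0 ≤ g t z) (h1 : ∀ t z, g t z ≤ 1) (σ : Fin n → ℤˣ) :
    Measurable (signedGap g σ) := by
  refine measurable_iSup_of_continuous (fun t => ?_) (bddAbove_signed_mean_diff hn h0 h1 σ)
  have := hg t
  fun_prop

/-- Symmetrization: the expected uniform deviation is at most twice the Rademacher complexity. -/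
theorem integral_uniformDeviation_le [Nonempty ι] (hn : 1 ≤ n) (P : Measure Z)
    [IsProbabilityMeasure P] {g : ι → Z → ℝ} (hg : ∀ t, Continuous (g t))
    (h0 : ∀ t z, 0 ≤ g t z) (h1 : ∀ t z, g t z ≤ 1) :
    ∫ S : Fin n → Z, uniformDeviation P g S ∂(Measure.pi fun _ => P)
      ≤ 2 * rademacher P n (Set.range g) := by
  set μ : Measure (Fin n → Z) := Measure.pi fun _ => P with hμ
  have hn0 : (n : ℝ) ≠ 0 := by positivity
  have hgap : ∀ σ, Integrable (signedGap (n := n) g σ) (μ.prod μ) := fun σ =>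
    integrable_of_measurable_of_abs_le (measurable_signedGap hn hg h0 h1 σ)
      (abs_signedGap_le hn h0 h1 σ)
  have hgi : ∀ t, Integrable (g t) P := fun t =>
    integrable_of_measurable_of_abs_le (hg t).measurable (B := 1)
      fun z => abs_le.2 ⟨by linarith [h0 t z], h1 t z⟩
  -- The expectation of g is the mean of its ghost sample average, and a supremum of means is at
  -- most the mean of the supremum.
  have hpoint : ∀ S : Fin n → Z, uniformDeviation P g S ≤ ∫ S', signedGap g 1 (S, S') ∂μ := by
    intro S
    refine ciSup_le fun t => ?_
    have hev : ∀ i, Integrable (fun S' : Fin n → Z => g t (S' i)) μ := fun i =>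
      integrable_comp_eval (hgi t)
    have e : ∫ z, g t z ∂P - (1 / n : ℝ) * ∑ i, g t (S i)
        = ∫ S' : Fin n → Z,
          (1 / n : ℝ) * ∑ i, (((1 : Fin n → ℤˣ) i : ℤ) : ℝ) * (g t (S' i) - g t (S i)) ∂μ := by
      simp only [Pi.one_apply, Units.val_one, Int.cast_one, one_mul]
      rw [integral_const_mul, integral_finsetSum (f := fun i (S' : Fin n → Z) => g t (S' i) - g t (S i)) _
          fun i _ => (hev i).sub (integrable_const _)]
      have e' : ∀ i, ∫ S' : Fin n → Z, (g t (S' i) - g t (S i)) ∂μ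
          = ∫ z, g t z ∂P - g t (S i) := fun i => by
        rw [integral_sub (hev i) (integrable_const _),
          integral_comp_eval (μ := fun _ : Fin n => P) (hg t).aestronglyMeasurable]
        simp
      simp only [e', Finset.sum_sub_distrib, Finset.sum_const, Finset.card_univ, Fintype.card_fin,
        nsmul_eq_mul]
      field_simp
    rw [e]
    refine integral_mono ?_ ?_ fun S' =>
      le_ciSup (bddAbove_signed_mean_diff hn h0 h1 1 (S, S')) t
    · exact (integrable_finsetSum _ fun i _ =>
        ((hev i).sub (integrable_const _)).const_mul _).const_mul _
    · exact integrable_of_measurable_of_abs_le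
        ((measurable_signedGap hn hg h0 h1 1).comp measurable_prodMk_left)
        fun S' => abs_signedGap_le hn h0 h1 1 (S, S')
  -- A sign −1 amounts to exchanging a point with its ghost, which leaves the joint law unchanged.
  have hswap : ∀ σ : Fin n → ℤˣ,
      ∫ p, signedGap g σ p ∂(μ.prod μ) = ∫ p, signedGap g 1 p ∂(μ.prod μ) := fun σ => by
    have hs := measurePreserving_signedSwap P σ
    rw [← hμ] at hs
    conv_rhs => rw [← hs.map_eq]
    rw [integral_map hs.measurable.aemeasurable
      (measurable_signedGap hn hg h0 h1 1).aestronglyMeasurable]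
    simp only [signedGap_one_signedSwap]
  have hemp : Integrable (fun S : Fin n → Z => empRademacher (Set.range g) S) μ :=
    integrable_empRademacher hn P (Set.range_nonempty g) (by rintro _ ⟨t, rfl⟩; exact hg t)
      (B := fun _ => 1) (by
        rintro _ ⟨t, rfl⟩ z
        exact abs_le.2 ⟨by linarith [h0 t z], h1 t z⟩) (C := 1) (by simp)
  calc ∫ S, uniformDeviation P g S ∂μ ≤ ∫ S, ∫ S', signedGap g 1 (S, S') ∂μ ∂μ := by
        refine integral_mono ?_ (hgap 1).integral_prod_left hpoint
        exact integrable_of_measurable_of_abs_le (measurable_uniformDeviation hn P hg h0 h1)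
          fun S => abs_iSup_le_of_abs_le (abs_deviation_le hn P h0 h1 S)
    _ = ∫ p, signedGap g 1 p ∂(μ.prod μ) := (integral_prod _ (hgap 1)).symm
    _ = (1 / 2 ^ n : ℝ) * ∑ σ : Fin n → ℤˣ, ∫ p, signedGap g σ p ∂(μ.prod μ) := by
        simp only [hswap]
        simp
    _ = ∫ p, (1 / 2 ^ n : ℝ) * ∑ σ : Fin n → ℤˣ, signedGap g σ p ∂(μ.prod μ) := by
        rw [integral_const_mul, integral_finsetSum _ fun σ _ => hgap σ]
    _ ≤ ∫ p, (empRademacher (Set.range g) p.1 + empRademacher (Set.range g) p.2)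
          ∂(μ.prod μ) :=
        integral_mono ((integrable_finsetSum _ fun σ _ => hgap σ).const_mul _)
          ((hemp.comp_fst μ).add (hemp.comp_snd μ)) (mean_signedGap_le h0 h1)
    _ = 2 * rademacher P n (Set.range g) := by
        rw [integral_add (hemp.comp_fst μ) (hemp.comp_snd μ),
          integral_fun_fst (fun S => empRademacher (Set.range g) S),
          integral_fun_snd (fun S => empRademacher (Set.range g) S)]
        simp [rademacher, hμ, two_mul]

/-- The Rademacher generalization bound for a class of continuous `[0, 1]`-valued functions. -/
theorem rademacher_generalization_bound [Nonempty ι] (hn : 1 ≤ n) (P : Measure Z)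
    [IsProbabilityMeasure P] {g : ι → Z → ℝ} (hg : ∀ t, Continuous (g t))
    (h0 : ∀ t z, 0 ≤ g t z) (h1 : ∀ t z, g t z ≤ 1) {δ : ℝ} (hδ : 0 < δ) (hδ1 : δ < 1) :
    ENNReal.ofReal (1 - δ) ≤ (Measure.pi fun _ : Fin n => P)
      {S | ∀ t, ∫ z, g t z ∂P ≤ (1 / n : ℝ) * ∑ i, g t (S i)
        + 2 * rademacher P n (Set.range g) + √(Real.log (1 / δ) / (2 * n))} := by
  set μ : Measure (Fin n → Z) := Measure.pi fun _ => P with hμ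
  set ε := √(Real.log (1 / δ) / (2 * n)) with hε
  have hn0 : (0 : ℝ) < n := by exact_mod_cast hn
  have hm := measurable_uniformDeviation (n := n) hn P hg h0 h1
  set A : Set (Fin n → Z) :=
    {S | ε ≤ uniformDeviation P g S - ∫ S', uniformDeviation P g S' ∂μ} with hA
  have hAm : MeasurableSet A := measurableSet_le measurable_const (hm.sub_const _)
  have hAle : μ A ≤ ENNReal.ofReal δ := by
    have := measureReal_ge_le_of_boundedDifferences P hm
      (fun S => abs_iSup_le_of_abs_le (abs_deviation_le hn P h0 h1 S))
      (abs_uniformDeviation_update_sub_le hn P h0 h1) (Real.sqrt_nonneg _ : 0 ≤ ε)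
    have hl : 0 ≤ Real.log (1 / δ) := Real.log_nonneg (by rw [le_div_iff₀ hδ]; linarith)
    -- Differences are bounded by 1/n, so the exponent is −2nε²; ε is chosen to make it −log(1/δ).
    have e : -ε ^ 2 / (2 * (n * ((1 / n : ℝ) ^ 2 / 4))) = -Real.log (1 / δ) := by
      rw [hε, Real.sq_sqrt (by positivity)]
      field_simp
      norm_num
    have e₂ : Real.exp (-Real.log (1 / δ)) = δ := by
      rw [Real.exp_neg, Real.exp_log (by positivity), one_div, inv_inv]
    rw [e, e₂] at this
    rw [← ofReal_measureReal]
    exact ENNReal.ofReal_le_ofReal this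
  calc ENNReal.ofReal (1 - δ) = 1 - ENNReal.ofReal δ := by
        rw [ENNReal.ofReal_sub _ hδ.le, ENNReal.ofReal_one]
    _ ≤ 1 - μ A := tsub_le_tsub_left hAle _
    _ = μ Aᶜ := (prob_compl_eq_one_sub hAm).symm
    _ ≤ _ := measure_mono ?_
  intro S hS t
  have hS' : uniformDeviation P g S - ∫ S', uniformDeviation P g S' ∂μ < ε := not_le.1 hS
  have h2 := integral_uniformDeviation_le (n := n) hn P hg h0 h1
  have h3 : ∫ z, g t z ∂P - (1 / n : ℝ) * ∑ i, g t (S i) ≤ uniformDeviation P g S :=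
    le_ciSup (bddAbove_deviation hn P h0 h1 S) t
  linarith

end Generalization

/-! ### Hinge classes and their sums. -/

section Hinge

variable {d k n : ℕ}

/-- The function `(x, y) ↦ [θ_y ± w · x]₊`. -/
noncomputable def hinge (θ : Fin k → ℝ) (s : Fin k → ℤˣ) (w : EuclideanSpace ℝ (Fin d))
    (z : Example d k) : ℝ :=
  max (θ z.2 + ((s z.2 : ℤ) : ℝ) * inner ℝ w z.1) 0

theorem hingeClass_eq_range (θ : Fin k → ℝ) (s : Fin k → ℤˣ) (Λ : ℝ) :
    (hingeClass θ s Λ : Set (Example d k → ℝ))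
      = Set.range fun w : Metric.closedBall (0 : EuclideanSpace ℝ (Fin d)) Λ => hinge θ s w := by
  ext f
  constructor
  · rintro ⟨w, hw, rfl⟩
    exact ⟨⟨w, mem_closedBall_zero_iff.2 hw⟩, rfl⟩
  · rintro ⟨w, rfl⟩
    exact ⟨w, mem_closedBall_zero_iff.1 w.2, rfl⟩

theorem hingeClass_nonempty (θ : Fin k → ℝ) (s : Fin k → ℤˣ) {Λ : ℝ} (hΛ : 0 ≤ Λ) :
    (hingeClass θ s Λ : Set (Example d k → ℝ)).Nonempty :=
  ⟨_, 0, by simpa using hΛ, rfl⟩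

theorem continuous_hinge (θ : Fin k → ℝ) (s : Fin k → ℤˣ) (w : EuclideanSpace ℝ (Fin d)) :
    Continuous (hinge θ s w) := by
  -- The label space is discrete, so any dependence on the label is continuous.
  have h₁ : Continuous fun z : Example d k => θ z.2 :=
    continuous_of_discreteTopology.comp continuous_snd
  have h₂ : Continuous fun z : Example d k => ((s z.2 : ℤ) : ℝ) :=
    (continuous_of_discreteTopology (f := fun y => ((s y : ℤ) : ℝ))).comp continuous_snd
  have h₃ : Continuous fun z : Example d k => inner ℝ w z.1 :=
    continuous_const.inner continuous_fst
  exact (h₁.add (h₂.mul h₃)).max continuous_const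

theorem abs_inner_le_of_norm_le {E : Type*} [NormedAddCommGroup E] [InnerProductSpace ℝ E] {w : E}
    {Λ : ℝ} (hw : ‖w‖ ≤ Λ) (x : E) : |inner ℝ w x| ≤ Λ * ‖x‖ :=
  (abs_real_inner_le_norm w x).trans (mul_le_mul_of_nonneg_right hw (norm_nonneg x))

theorem abs_hinge_le (θ : Fin k → ℝ) (s : Fin k → ℤˣ) {w : EuclideanSpace ℝ (Fin d)} {Λ : ℝ}
    (hw : ‖w‖ ≤ Λ) (z : Example d k) : |hinge θ s w z| ≤ (∑ y, |θ y|) + Λ * ‖z.1‖ := by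
  have h : |θ z.2| ≤ ∑ y, |θ y| :=
    Finset.single_le_sum (f := fun y => |θ y|) (fun y _ => abs_nonneg _) (Finset.mem_univ z.2)
  calc |hinge θ s w z| ≤ |θ z.2 + ((s z.2 : ℤ) : ℝ) * inner ℝ w z.1| := by
        simpa [hinge] using abs_max_sub_max_le_abs (θ z.2 + ((s z.2 : ℤ) : ℝ) * inner ℝ w z.1) 0 0
    _ ≤ |θ z.2| + |((s z.2 : ℤ) : ℝ) * inner ℝ w z.1| := abs_add_le _ _
    _ ≤ _ := by
        rw [abs_mul, abs_intUnit_cast, one_mul]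
        exact add_le_add h (abs_inner_le_of_norm_le hw _)

theorem abs_le_of_mem_hingeClass {θ : Fin k → ℝ} {s : Fin k → ℤˣ} {Λ : ℝ} {f : Example d k → ℝ}
    (hf : f ∈ hingeClass θ s Λ) (z : Example d k) : |f z| ≤ (∑ y, |θ y|) + Λ * ‖z.1‖ := by
  obtain ⟨w, hw, rfl⟩ := hf
  exact abs_hinge_le θ s hw z

theorem continuous_of_mem_hingeClass {θ : Fin k → ℝ} {s : Fin k → ℤˣ} {Λ : ℝ}
    {f : Example d k → ℝ} (hf : f ∈ hingeClass θ s Λ) : Continuous f := by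
  obtain ⟨w, _, rfl⟩ := hf
  exact continuous_hinge θ s w

theorem empRademacher_hingeClass_le (hn : 1 ≤ n) (θ : Fin k → ℝ) (s : Fin k → ℤˣ) {R Λ : ℝ}
    (hΛ : 0 ≤ Λ) {S : Fin n → Example d k} (hS : ∀ i, ‖(S i).1‖ ≤ R) :
    empRademacher (hingeClass θ s Λ) S ≤ R * Λ / √n := by
  have hR : 0 ≤ R := (norm_nonneg _).trans (hS ⟨0, hn⟩)
  have hn0 : (0 : ℝ) < n := by exact_mod_cast hn
  have : Nonempty (Metric.closedBall (0 : EuclideanSpace ℝ (Fin d)) Λ) := ⟨⟨0, by simpa using hΛ⟩⟩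
  rw [hingeClass_eq_range]
  refine (empRademacher_range_le_of_contraction
    (h := fun (w : Metric.closedBall (0 : EuclideanSpace ℝ (Fin d)) Λ) (z : Example d k) =>
      inner ℝ (w : EuclideanSpace ℝ (Fin d)) z.1)
    (fun w i => abs_hinge_le θ s (mem_closedBall_zero_iff.1 w.2) (S i))
    (fun w i => abs_inner_le_of_norm_le (mem_closedBall_zero_iff.1 w.2) (S i).1)
    fun i w w' => ?_).trans ?_
  · refine (abs_max_sub_max_le_abs _ _ _).trans (le_of_eq ?_)
    rw [add_sub_add_left_eq_sub, ← mul_sub, abs_mul, abs_intUnit_cast, one_mul]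
  · rw [empRademacher_range_eq_mul]
    have h := sum_iSup_signed_inner_le (fun i => (S i).1) hR hΛ hS
    rw [Fintype.card_fin] at h
    calc _ ≤ (1 / 2 ^ n : ℝ) * ((1 / n : ℝ) * (2 ^ n * (Λ * (R * √n)))) := by gcongr
      _ = R * Λ * (√n / n) := by field_simp
      _ = R * Λ / √n := by rw [Real.sqrt_div_self']; ring

theorem empRademacher_minkowskiSum_hingeClass_le (hn : 1 ≤ n) (θ : Fin k → ℝ)
    (s : Fin k → Fin k → ℤˣ) {R : ℝ} {Λ : Fin k → ℝ} (hΛ : ∀ j, 0 ≤ Λ j)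
    {S : Fin n → Example d k} (hS : ∀ i, ‖(S i).1‖ ≤ R) :
    empRademacher (minkowskiSum fun j => hingeClass θ (s j) (Λ j)) S
      ≤ R * (∑ j, Λ j) / √n := by
  refine (empRademacher_minkowskiSum_le
    (B := fun i => (∑ y, |θ y|) + (∑ j, Λ j) * ‖(S i).1‖)
    (fun j => hingeClass_nonempty θ (s j) (hΛ j)) fun j f hf i => ?_).trans ?_
  · refine (abs_le_of_mem_hingeClass hf (S i)).trans ?_
    gcongr
    exact Finset.single_le_sum (f := Λ) (fun j _ => hΛ j) (Finset.mem_univ j)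
  · refine (Finset.sum_le_sum fun j _ => empRademacher_hingeClass_le hn θ (s j) (hΛ j) hS).trans ?_
    rw [Finset.mul_sum, Finset.sum_div]

theorem minkowskiSum_nonempty {Z : Type*} {F : Fin k → Set (Z → ℝ)} (hF : ∀ j, (F j).Nonempty) :
    (minkowskiSum F).Nonempty :=
  ⟨_, fun j => (hF j).some, fun j => (hF j).some_mem, rfl⟩

theorem abs_le_of_mem_minkowskiSum_hingeClass {θ : Fin k → ℝ} {s : Fin k → Fin k → ℤˣ}
    {Λ : Fin k → ℝ} {f : Example d k → ℝ}
    (hf : f ∈ minkowskiSum fun j => hingeClass θ (s j) (Λ j)) (z : Example d k) :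
    |f z| ≤ ∑ j, ((∑ y, |θ y|) + Λ j * ‖z.1‖) := by
  obtain ⟨f, hf, rfl⟩ := hf
  exact (Finset.abs_sum_le_sum_abs _ _).trans
    (Finset.sum_le_sum fun j _ => abs_le_of_mem_hingeClass (hf j) z)

theorem continuous_of_mem_minkowskiSum_hingeClass {θ : Fin k → ℝ} {s : Fin k → Fin k → ℤˣ}
    {Λ : Fin k → ℝ} {f : Example d k → ℝ}
    (hf : f ∈ minkowskiSum fun j => hingeClass θ (s j) (Λ j)) : Continuous f := by
  obtain ⟨f, hf, rfl⟩ := hf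
  exact continuous_finsetSum _ fun j _ => continuous_of_mem_hingeClass (hf j)

theorem rademacher_le_of_forall_sample {F : Set (Example d k → ℝ)} (P : Measure (Example d k))
    [IsProbabilityMeasure P] {R C : ℝ} (hP : ∀ᵐ z ∂P, ‖z.1‖ ≤ R)
    (hi : Integrable (fun S : Fin n → Example d k => empRademacher F S) (Measure.pi fun _ => P))
    (h : ∀ S : Fin n → Example d k, (∀ i, ‖(S i).1‖ ≤ R) → empRademacher F S ≤ C) :
    rademacher P n F ≤ C := by
  have hae : ∀ᵐ S : Fin n → Example d k ∂(Measure.pi fun _ => P), ∀ i, ‖(S i).1‖ ≤ R :=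
    ae_all_iff.2 fun i =>
      (Measure.tendsto_eval_ae_ae (μ := fun _ : Fin n => P) (i := i)).eventually hP
  calc rademacher P n F ≤ ∫ _S : Fin n → Example d k, C ∂(Measure.pi fun _ => P) :=
        integral_mono_ae hi (integrable_const _) (hae.mono h)
    _ = C := by simp

theorem integrable_empRademacher_hingeClass (hn : 1 ≤ n) (θ : Fin k → ℝ) (s : Fin k → ℤˣ)
    {R Λ : ℝ} (hΛ : 0 ≤ Λ) (P : Measure (Example d k)) [IsProbabilityMeasure P]
    (hP : ∀ᵐ z ∂P, ‖z.1‖ ≤ R) :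
    Integrable (fun S : Fin n → Example d k => empRademacher (hingeClass θ s Λ) S)
      (Measure.pi fun _ => P) :=
  integrable_empRademacher hn P (hingeClass_nonempty θ s hΛ)
    (fun _ hf => continuous_of_mem_hingeClass hf) (fun _ hf => abs_le_of_mem_hingeClass hf)
    (C := (∑ y, |θ y|) + Λ * R) (hP.mono fun z hz => by gcongr)

theorem integrable_empRademacher_minkowskiSum_hingeClass (hn : 1 ≤ n) (θ : Fin k → ℝ)
    (s : Fin k → Fin k → ℤˣ) {R : ℝ} {Λ : Fin k → ℝ} (hΛ : ∀ j, 0 ≤ Λ j)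
    (P : Measure (Example d k)) [IsProbabilityMeasure P] (hP : ∀ᵐ z ∂P, ‖z.1‖ ≤ R) :
    Integrable (fun S : Fin n → Example d k =>
      empRademacher (minkowskiSum fun j => hingeClass θ (s j) (Λ j)) S)
      (Measure.pi fun _ => P) :=
  integrable_empRademacher hn P
    (minkowskiSum_nonempty fun j => hingeClass_nonempty θ (s j) (hΛ j))
    (fun _ hf => continuous_of_mem_minkowskiSum_hingeClass hf)
    (fun _ hf => abs_le_of_mem_minkowskiSum_hingeClass hf)
    (C := ∑ j, ((∑ y, |θ y|) + Λ j * R)) (hP.mono fun z hz => by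
      gcongr with j
      exact hΛ j)

/-- Cauchy–Schwarz against the all-ones vector. -/
theorem mul_sum_div_sqrt_le_frobenius {R : ℝ} (hR : 0 ≤ R) (Λ : Fin k → ℝ) (n : ℕ) :
    R * (∑ j, Λ j) / √n ≤ R * frobeniusOfRows Λ * √((k : ℝ) / n) := by
  have h : ∑ j, Λ j ≤ √k * frobeniusOfRows Λ := by
    rw [frobeniusOfRows, ← Real.sqrt_mul (by positivity)]
    refine Real.le_sqrt_of_sq_le ?_
    simpa using sq_sum_le_card_mul_sum_sq (s := Finset.univ) (f := Λ)
  rw [Real.sqrt_div (by positivity), ← mul_div_assoc]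
  refine div_le_div_of_nonneg_right ?_ (Real.sqrt_nonneg _)
  rw [mul_assoc]
  refine mul_le_mul_of_nonneg_left ?_ hR
  linarith

end Hinge

/-! ### The clipped surrogate loss. -/

section ClippedLoss

variable {d k n : ℕ}

/-- The signs with which the surrogate loss is a sum of hinge functions. -/
def surrogateSign (j y : Fin k) : ℤˣ := if y = j then -1 else 1

theorem surrogateLoss_eq_sum_hinge (θ : Fin k → ℝ) (W : Fin k → EuclideanSpace ℝ (Fin d))
    (z : Example d k) : surrogateLoss θ W z = ∑ j, hinge θ (surrogateSign j) (W j) z := by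
  refine Finset.sum_congr rfl fun j _ => ?_
  have e : ((surrogateSign j z.2 : ℤ) : ℝ) = -signedDelta z.2 j := by
    unfold surrogateSign signedDelta
    split_ifs <;> simp
  rw [hinge, e]
  split_ifs with h
  · rw [max_eq_left (by linarith)]; ring
  · rw [max_eq_right (by linarith)]

theorem surrogateLoss_nonneg (θ : Fin k → ℝ) (W : Fin k → EuclideanSpace ℝ (Fin d))
    (z : Example d k) : 0 ≤ surrogateLoss θ W z := by
  rw [surrogateLoss_eq_sum_hinge]
  exact Finset.sum_nonneg fun j _ => le_max_right _ _

theorem surrogateLoss_mem_minkowskiSum (θ : Fin k → ℝ) {W : Fin k → EuclideanSpace ℝ (Fin d)}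
    {Λ : Fin k → ℝ} (hW : ∀ j, ‖W j‖ ≤ Λ j) :
    surrogateLoss θ W ∈ minkowskiSum fun j => hingeClass θ (surrogateSign j) (Λ j) :=
  ⟨fun j => hinge θ (surrogateSign j) (W j), fun j => ⟨W j, hW j, rfl⟩,
    funext fun z => surrogateLoss_eq_sum_hinge θ W z⟩

theorem thetaMax_pos [Nonempty (Fin k)] {θ : Fin k → ℝ} (hθ : ∀ y, 0 < θ y) : 0 < thetaMax θ := by
  obtain ⟨y⟩ := ‹Nonempty (Fin k)›
  exact (hθ y).trans_le (le_ciSup (Set.finite_range θ).bddAbove y)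

/-- Clipping u ↦ min(u, θ_max) is 1-Lipschitz. -/
theorem abs_clippedLoss_sub_le {θ : Fin k → ℝ} (hθ : 0 < thetaMax θ)
    (W W' : Fin k → EuclideanSpace ℝ (Fin d)) (z : Example d k) :
    |clippedLoss θ W z - clippedLoss θ W' z|
      ≤ |1 / thetaMax θ * surrogateLoss θ W z - 1 / thetaMax θ * surrogateLoss θ W' z| := by
  unfold clippedLoss
  rw [← sub_div, ← mul_sub, abs_div, abs_mul, abs_of_pos hθ, abs_of_pos (one_div_pos.2 hθ),
    one_div, inv_mul_eq_div]
  refine div_le_div_of_nonneg_right ?_ hθ.le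
  have h := abs_min_sub_min_le_max (surrogateLoss θ W z) (thetaMax θ) (surrogateLoss θ W' z)
    (thetaMax θ)
  rwa [sub_self, abs_zero, max_eq_left (abs_nonneg (_ - _))] at h

theorem clippedLoss_nonneg {θ : Fin k → ℝ} (hθ : 0 < thetaMax θ)
    (W : Fin k → EuclideanSpace ℝ (Fin d)) (z : Example d k) : 0 ≤ clippedLoss θ W z :=
  div_nonneg (le_min (surrogateLoss_nonneg θ W z) hθ.le) hθ.le

theorem clippedLoss_le_one {θ : Fin k → ℝ} (hθ : 0 < thetaMax θ)
    (W : Fin k → EuclideanSpace ℝ (Fin d)) (z : Example d k) : clippedLoss θ W z ≤ 1 :=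
  (div_le_one hθ).2 (min_le_right _ _)

theorem continuous_clippedLoss (θ : Fin k → ℝ) (W : Fin k → EuclideanSpace ℝ (Fin d)) :
    Continuous (clippedLoss θ W) := by
  -- The radii Λ j = ‖W j‖ place an arbitrary W in a class.
  have : Continuous (surrogateLoss θ W) := continuous_of_mem_minkowskiSum_hingeClass
    (surrogateLoss_mem_minkowskiSum θ fun j => le_refl ‖W j‖)
  exact (this.min continuous_const).div_const _

/-- Contraction removes the clipping, the factor 1/θ_max comes out, and the surrogate losses lie in
the Minkowski sum. No norm bound on the sample is needed, so this integrates pointwise. -/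
theorem empRademacher_clippedLoss_le {θ : Fin k → ℝ} (hθ : 0 < thetaMax θ) {Λ : Fin k → ℝ}
    (hΛ : ∀ j, 0 ≤ Λ j) (S : Fin n → Example d k) :
    empRademacher (Set.range fun W : {W : Fin k → EuclideanSpace ℝ (Fin d) // ∀ j, ‖W j‖ ≤ Λ j} =>
        clippedLoss θ (W : Fin k → EuclideanSpace ℝ (Fin d))) S
      ≤ 1 / thetaMax θ
        * empRademacher (minkowskiSum fun j => hingeClass θ (surrogateSign j) (Λ j)) S := by
  have : Nonempty {W : Fin k → EuclideanSpace ℝ (Fin d) // ∀ j, ‖W j‖ ≤ Λ j} :=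
    ⟨⟨0, fun j => by simpa using hΛ j⟩⟩
  refine (empRademacher_range_le_of_contraction (B := fun _ => 1)
    (h := fun (W : {W : Fin k → EuclideanSpace ℝ (Fin d) // ∀ j, ‖W j‖ ≤ Λ j}) z =>
      1 / thetaMax θ * surrogateLoss θ (W : Fin k → EuclideanSpace ℝ (Fin d)) z)
    (C := fun i => |1 / thetaMax θ| * ∑ j, ((∑ y, |θ y|) + Λ j * ‖(S i).1‖))
    (fun W i => ?_) (fun W i => ?_) fun i W W' => abs_clippedLoss_sub_le hθ _ _ _).trans ?_
  · rw [abs_of_nonneg (clippedLoss_nonneg hθ _ _)]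
    exact clippedLoss_le_one hθ _ _
  · rw [abs_mul]
    exact mul_le_mul_of_nonneg_left (abs_le_of_mem_minkowskiSum_hingeClass
      (surrogateLoss_mem_minkowskiSum θ W.2) (S i)) (abs_nonneg _)
  · rw [empRademacher_const_smul_range (one_div_pos.2 hθ).le]
    refine mul_le_mul_of_nonneg_left ?_ (one_div_pos.2 hθ).le
    refine empRademacher_mono (Set.range_nonempty _) ?_
      fun f hf i => abs_le_of_mem_minkowskiSum_hingeClass hf (S i)
    rintro _ ⟨W, rfl⟩
    exact surrogateLoss_mem_minkowskiSum θ W.2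

theorem rademacher_clippedLoss_le (hn : 1 ≤ n) {θ : Fin k → ℝ} (hθ : 0 < thetaMax θ) {R : ℝ}
    {Λ : Fin k → ℝ} (hΛ : ∀ j, 0 ≤ Λ j) (P : Measure (Example d k)) [IsProbabilityMeasure P]
    (hP : ∀ᵐ z ∂P, ‖z.1‖ ≤ R) :
    rademacher P n
        (Set.range fun W : {W : Fin k → EuclideanSpace ℝ (Fin d) // ∀ j, ‖W j‖ ≤ Λ j} =>
          clippedLoss θ (W : Fin k → EuclideanSpace ℝ (Fin d)))
      ≤ 1 / thetaMax θ
        * rademacher P n (minkowskiSum fun j => hingeClass θ (surrogateSign j) (Λ j)) := by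
  have : Nonempty {W : Fin k → EuclideanSpace ℝ (Fin d) // ∀ j, ‖W j‖ ≤ Λ j} :=
    ⟨⟨0, fun j => by simpa using hΛ j⟩⟩
  unfold rademacher
  rw [← integral_const_mul]
  refine integral_mono ?_ ((integrable_empRademacher_minkowskiSum_hingeClass hn θ _ hΛ P
    hP).const_mul _) fun S => empRademacher_clippedLoss_le hθ hΛ S
  refine integrable_empRademacher hn P (Set.range_nonempty _) ?_ (B := fun _ => 1) ?_
    (C := 1) (by simp)
  · rintro _ ⟨W, rfl⟩
    exact continuous_clippedLoss θ W.1
  · rintro _ ⟨W, rfl⟩ z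
    rw [abs_of_nonneg (clippedLoss_nonneg hθ W.1 z)]
    exact clippedLoss_le_one hθ W.1 z

end ClippedLoss

/-! ### The three bounds together. -/

theorem mainTheorem2 (k d n : ℕ) (hn : 1 ≤ n)
    (θ : Fin k → ℝ) (hθ : ∀ y, 0 < θ y)
    (R : ℝ) (Λ : Fin k → ℝ) (hΛ : ∀ j, 0 ≤ Λ j)
    (P : Measure (Example d k)) [IsProbabilityMeasure P] (hP : ∀ᵐ z ∂P, ‖z.1‖ ≤ R) :
    -- each class `F_j`, for every choice of the signs
    (∀ (j : Fin k) (s : Fin k → ℤˣ),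
      (∀ S : Fin n → Example d k, (∀ i, ‖(S i).1‖ ≤ R) →
        empRademacher (hingeClass θ s (Λ j)) S ≤ R * Λ j / √n) ∧
      Integrable (fun S : Fin n → Example d k => empRademacher (hingeClass θ s (Λ j)) S)
        (Measure.pi fun _ => P) ∧
      rademacher P n (hingeClass θ s (Λ j)) ≤ R * Λ j / √n) ∧
    -- the Minkowski sum `F`, for every choice of the signs
    (∀ s : Fin k → Fin k → ℤˣ,
      (∀ S : Fin n → Example d k, (∀ i, ‖(S i).1‖ ≤ R) →
        empRademacher (minkowskiSum fun j => hingeClass θ (s j) (Λ j)) S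
          ≤ R * (∑ j, Λ j) / √n) ∧
      Integrable (fun S : Fin n → Example d k =>
          empRademacher (minkowskiSum fun j => hingeClass θ (s j) (Λ j)) S)
        (Measure.pi fun _ => P) ∧
      rademacher P n (minkowskiSum fun j => hingeClass θ (s j) (Λ j))
        ≤ R * (∑ j, Λ j) / √n ∧
      R * (∑ j, Λ j) / √n ≤ R * frobeniusOfRows Λ * √((k : ℝ) / n)) ∧
    -- the generalization bound, uniformly over the weight matrices
    (∀ δ : ℝ, 0 < δ → δ < 1 →
      ENNReal.ofReal (1 - δ) ≤ (Measure.pi fun _ : Fin n => P)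
        {S : Fin n → Example d k |
          ∀ W : Fin k → EuclideanSpace ℝ (Fin d), (∀ j, ‖W j‖ ≤ Λ j) →
            ∫ z, clippedLoss θ W z ∂P
              ≤ (1 / n : ℝ) * ∑ i, clippedLoss θ W (S i)
                + 2 * R * (frobeniusOfRows Λ / thetaMax θ) * √((k : ℝ) / n)
                + √(Real.log (1 / δ) / (2 * n))}) := by
  -- One point satisfying the norm bound yields both R ≥ 0 and, through its label, k ≥ 1.
  obtain ⟨z₀, hz₀⟩ := hP.exists
  have hR : 0 ≤ R := (norm_nonneg _).trans hz₀
  have hsum : ∀ s : Fin k → Fin k → ℤˣ,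
      rademacher P n (minkowskiSum fun j => hingeClass θ (s j) (Λ j)) ≤ R * (∑ j, Λ j) / √n :=
    fun s => rademacher_le_of_forall_sample P hP
      (integrable_empRademacher_minkowskiSum_hingeClass hn θ s hΛ P hP)
      fun S hS => empRademacher_minkowskiSum_hingeClass_le hn θ s hΛ hS
  refine ⟨fun j s => ⟨fun S hS => empRademacher_hingeClass_le hn θ s (hΛ j) hS,
    integrable_empRademacher_hingeClass hn θ s (hΛ j) P hP, ?_⟩,
    fun s => ⟨fun S hS => empRademacher_minkowskiSum_hingeClass_le hn θ s hΛ hS,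
      integrable_empRademacher_minkowskiSum_hingeClass hn θ s hΛ P hP, hsum s,
      mul_sum_div_sqrt_le_frobenius hR Λ n⟩, fun δ hδ hδ1 => ?_⟩
  · exact rademacher_le_of_forall_sample P hP
      (integrable_empRademacher_hingeClass hn θ s (hΛ j) P hP)
      fun S hS => empRademacher_hingeClass_le hn θ s (hΛ j) hS
  have : Nonempty (Fin k) := ⟨z₀.2⟩
  have hθm := thetaMax_pos hθ
  have : Nonempty {W : Fin k → EuclideanSpace ℝ (Fin d) // ∀ j, ‖W j‖ ≤ Λ j} :=
    ⟨⟨0, fun j => by simpa using hΛ j⟩⟩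
  have hrad := (rademacher_clippedLoss_le hn hθm hΛ P hP).trans (mul_le_mul_of_nonneg_left
    ((hsum _).trans (mul_sum_div_sqrt_le_frobenius hR Λ n)) (one_div_pos.2 hθm).le)
  have e : 1 / thetaMax θ * (R * frobeniusOfRows Λ * √((k : ℝ) / n))
      = R * (frobeniusOfRows Λ / thetaMax θ) * √((k : ℝ) / n) := by ring
  rw [e] at hrad
  refine (rademacher_generalization_bound hn P
    (g := fun W : {W : Fin k → EuclideanSpace ℝ (Fin d) // ∀ j, ‖W j‖ ≤ Λ j} =>
      clippedLoss θ (W : Fin k → EuclideanSpace ℝ (Fin d)))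
    (fun W => continuous_clippedLoss θ W.1) (fun W z => clippedLoss_nonneg hθm W.1 z)
    (fun W z => clippedLoss_le_one hθm W.1 z) hδ hδ1).trans (measure_mono ?_)
  intro S hS W hW
  have h := hS ⟨W, hW⟩
  beta_reduce at h
  linarith
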